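/- Theorem ($F_4(a_2)$). Work over $\mathbb C$ with coordinates $t=(t_1,t_2,t_3,t_4)$. Consider the cubic equation $P(t_2,t_3,t_4,Z)=0$, where \begin{align*} P = {}& Z^{3} - \frac{2^{3}\cdot 3^{4}\cdot 13}{5^{4}}\,\bigl(\frac{2^{3}\cdot 3}{13}\,t_4^{2} + t_4\,t_3 \\ & + \frac{13}{2^{5}\cdot 3}\,t_3^{2}\bigr)\,Z \\ & + \frac{2^{2}\cdot 3\cdot 13}{5^{6}}\,\bigl(\frac{2^{6}\cdot 5^{4}}{3^{3}\cdot 13^{2}}\,t_2 \\ & - \frac{2^{7}\cdot 139}{13}\,t_4^{3} - 2^{4}\cdot 3^{2}\cdot 23\,t_4^{2}\,t_3 \\ & - 3\cdot 13\cdot 73\,t_4\,t_3^{2} - \frac{13^{2}\cdot 41}{2^{4}}\,t_3^{3}\bigr), \end{align*} and the prepotential $F=A_0+A_1Z+A_2Z^2$ of Dinar's $F_4(a_2)$ Frobenius manifold, where \begin{align*} A_0 = {}& \frac{2^{5}\cdot 3^{7}\cdot 67\cdot 521749}{5^{9}\cdot 7}\,t_4^{7} \\ & + \frac{2^{4}\cdot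 3^{10}\cdot 13\cdot 693097}{5^{9}\cdot 7}\,t_4^{6}\,t_3 \\ & + \frac{2^{2}\cdot 3^{8}\cdot 13^{2}\cdot 23^{2}\cdot 7\cdot 97}{5^{9}}\,t_4^{5}\,t_3^{2} \\ & + \frac{3^{7}\cdot 13^{3}\cdot 18224639}{2^{6}\cdot 5^{8}\cdot 7}\,t_4^{4}\,t_3^{3} \\ & + \frac{3^{8}\cdot 13^{4}\cdot 7243667}{2^{11}\cdot 5^{8}\cdot 7}\,t_4^{3}\,t_3^{4} \\ & + \frac{3^{8}\cdot 13^{5}\cdot 8754721}{2^{14}\cdot 5^{9}\cdot 7}\,t_4^{2}\,t_3^{5} \\ & + \frac{3^{7}\cdot 13^{6}\cdot 19\cdot 435503}{2^{18}\cdot 5^{9}\cdot 7}\,t_4\,t_3^{6} \\ & + \frac{3^{8}\cdot 13^{7}\cdot 41\cdot 7129}{2^{22}\cdot 5^{9}\cdot 7}\,t_3^{7} \\ & + \frac{2^{4}\cdot 3^{4}\cdot 71\cdot 4259}{5^{5}\cdot 7\cdot 13}\,t_4^{4}\,t_2 \\ & - \frac{2^{3}\cdot 3^{4}\cdot 23\cdot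 47}{5^{5}\cdot 7}\,t_4^{3}\,t_3\,t_2 \\ & - \frac{3^{5}\cdot 13\cdot 103\cdot 293}{2^{3}\cdot 5^{5}\cdot 7}\,t_4^{2}\,t_3^{2}\,t_2 \\ & - \frac{3^{4}\cdot 13^{2}\cdot 79\cdot 467}{2^{6}\cdot 5^{5}\cdot 7}\,t_4\,t_3^{3}\,t_2 \\ & - \frac{3^{4}\cdot 13^{3}\cdot 157\cdot 383}{2^{12}\cdot 5^{5}\cdot 7}\,t_3^{4}\,t_2 \\ & + \frac{2^{4}}{13^{2}}\,t_4\,t_2^{2} - \frac{7}{13}\,t_3\,t_2^{2} + t_3\,t_2\,t_1 + \frac{t_4\,t_1^{2}}{2}, \end{align*} \begin{align*} A_1 = {}& \frac{2^{2}\cdot 3^{9}\cdot 89\cdot 11701}{5^{7}\cdot 7}\,t_4^{6} \\ & + \frac{3^{11}\cdot 13\cdot 68473}{5^{7}\cdot 7}\,t_4^{5}\,t_3 \\ & + \frac{3^{10}\cdot 13^{3}\cdot 1949}{2^{3}\cdot 5^{6}\cdot 7}\,t_4^{4}\,t_3^{2} \\ & + \frac{3^{9}\cdot 13^{3}\cdot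 131357}{2^{8}\cdot 5^{6}\cdot 7}\,t_4^{3}\,t_3^{3} \\ & + \frac{3^{12}\cdot 13^{4}\cdot 2729}{2^{12}\cdot 5^{6}\cdot 7}\,t_4^{2}\,t_3^{4} \\ & + \frac{3^{10}\cdot 13^{5}\cdot 15937}{2^{15}\cdot 5^{7}\cdot 7}\,t_4\,t_3^{5} \\ & + \frac{3^{9}\cdot 13^{6}\cdot 29\cdot 43}{2^{20}\cdot 5^{7}}\,t_3^{6} \\ & + \frac{3^{3}\cdot 5^{2}}{13^{2}\cdot 7}\,t_2^{2} \\ & - \frac{2^{2}\cdot 3^{6}\cdot 139}{5^{2}\cdot 7\cdot 13}\,t_4^{3}\,t_2 \\ & - \frac{3^{8}\cdot 23}{5^{2}\cdot 2\cdot 7}\,t_4^{2}\,t_3\,t_2 \\ & - \frac{3^{7}\cdot 13\cdot 73}{2^{5}\cdot 5^{2}\cdot 7}\,t_4\,t_3^{2}\,t_2 \\ & - \frac{3^{6}\cdot 13^{2}\cdot 41}{2^{9}\cdot 5^{2}\cdot 7}\,t_3^{3}\,t_2, \end{align*} \begin{align*} A_2 = {}& \frac{3^{14}\cdot 139}{5^{5}\cdot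 2\cdot 7}\,t_4^{5} \\ & + \frac{3^{13}\cdot 13\cdot 19}{5^{4}\cdot 2\cdot 7}\,t_4^{4}\,t_3 \\ & + \frac{3^{15}\cdot 13^{3}}{2^{11}\cdot 5^{4}}\,t_4^{2}\,t_3^{3} \\ & + \frac{3^{12}\cdot 13^{3}\cdot 101}{2^{9}\cdot 5^{4}\cdot 7}\,t_4^{3}\,t_3^{2} \\ & + \frac{3^{13}\cdot 13^{4}\cdot 31}{2^{16}\cdot 5^{4}\cdot 7}\,t_4\,t_3^{4} \\ & + \frac{3^{12}\cdot 13^{5}\cdot 41}{2^{20}\cdot 5^{5}\cdot 7}\,t_3^{5} \\ & - \frac{3^{11}}{2^{2}\cdot 5\cdot 7\cdot 13}\,t_4^{2}\,t_2 - \frac{3^{10}}{2^{5}\cdot 5\cdot 7}\,t_4\,t_3\,t_2 \\ & - \frac{3^{9}\cdot 13}{2^{10}\cdot 5\cdot 7}\,t_3^{2}\,t_2. \end{align*} Let $U\subseteq\mathbb C^4$ be open, let $Z:U\to\mathbb C$ be a holomorphic function with $P(t_2,t_3,t_4,Z(t))=0$ for all $t\in U$, and regard $F$ as the function $F(t)=F(t,Z(t))$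 on $U$. Put $$c_{ijk}=\frac{\partial^3F}{\partial t_i\partial t_j\partial t_k},\qquad \eta_{ij}=c_{ij1},\qquad (\eta^{ij})=(\eta_{ij})^{-1},\qquad c^{ij}_k=\eta^{i\alpha}\eta^{j\beta}c_{\alpha\beta k},$$ and let the intersection form be $g^{ij}(t)=E^\lambda c^{ij}_\lambda$ with Euler vector field $E=t_1\partial_{t_1}+t_2\partial_{t_2}+\frac13t_3\partial_{t_3}+\frac13t_4\partial_{t_4}$ (summation over repeated indices). Let $\epsilon_k$ be the $k$-th elementary symmetric polynomial in $x_1^2,x_2^2,x_3^2,x_4^2$. In orthonormal coordinates $x_1,\dots,x_4$ take the basic invariants of the Coxeter group $F_4$ \begin{align*} y_1={}&288\epsilon_2\epsilon_4-108\epsilon_1^2\epsilon_4-8\epsilon_2^3+3\epsilon_1^2\epsilon_2^2, & y_2={}&12\epsilon_4-3\epsilon_1\epsilon_3+\epsilon_2^2,\\ y_3={}&6\epsilon_3-\epsilon_1\epsilon_2, & y_4={}&\epsilon_1. \end{align*} (i) In these invariants, the intersection form $g^{ij}(x)=\delta^{ij}$ becomes the Saito form $\sum_{a=1}^4\frac{\partial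 y_i}{\partial x_a}\frac{\partial y_j}{\partial x_a}=G^{ij}(y)$ for all $x\in\mathbb C^4$, where $G$ is the symmetric matrix with entries \begin{align*} G^{11}={}& 1152\,y_2^{2}\,y_3 - 144\,y_1\,y_2\,y_4 + 1152\,y_2\,y_3^{2}\,y_4 - 144\,y_1\,y_3\,y_4^{2} + 288\,y_3^{3}\,y_4^{2} \\ G^{12}={}& -96\,y_2^{2}\,y_4 - 48\,y_2\,y_3\,y_4^{2} \\ G^{13}={}& 192\,y_2^{2} + 120\,y_2\,y_3\,y_4 - 12\,y_1\,y_4^{2} + 12\,y_3^{2}\,y_4^{2} \\ G^{14}={}& 24\,y_1 \\ G^{22}={}& -8\,y_2\,y_3 - y_1\,y_4 + 3\,y_3^{2}\,y_4 \\ G^{23}={}& 2\,y_1 - 6\,y_3^{2} - 8\,y_2\,y_4^{2} \\ G^{24}={}& 16\,y_2 \\ G^{33}={}& 20\,y_2\,y_4 - 4\,y_3\,y_4^{2} \\ G^{34}={}& 12\,y_3 \\ G^{44}={}& 4\,y_4. \end{align*} (ii) Define functions of $t$ on $U$, with $Z=Z(t)$, by $y_1=\frac{1}{2^{15}\cdot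 3^{9}\cdot 5^{6}\cdot 13^{2}}\,(B_0+B_1Z+B_2Z^2)$, where \begin{align*} B_0 = {}& 2^{17}\cdot 5^{8}\cdot 13^{2}\,t_1^{2} - 2^{22}\cdot 5^{8}\cdot 13\,t_1\,t_2 \\ & + 2^{22}\cdot 5^{8}\cdot 17\,t_2^{2} + 2^{13}\cdot 3^{3}\cdot 5^{4}\cdot 13^{5}\cdot 7\cdot 29\,t_1\,t_3^{3} \\ & - 2^{12}\cdot 3^{3}\cdot 5^{5}\cdot 13^{4}\cdot 491\,t_2\,t_3^{3} + 3^{6}\cdot 13^{8}\cdot 1202837\,t_3^{6} \\ & + 2^{17}\cdot 3^{4}\cdot 5^{4}\cdot 13^{4}\cdot 59\,t_1\,t_3^{2}\,t_4 \\ & + 2^{16}\cdot 3^{4}\cdot 5^{5}\cdot 13^{3}\cdot 67\,t_2\,t_3^{2}\,t_4 \\ & + 2^{5}\cdot 3^{7}\cdot 13^{8}\cdot 111347\,t_3^{5}\,t_4 \\ & - 2^{19}\cdot 3^{4}\cdot 5^{4}\cdot 13^{3}\cdot 367\,t_1\,t_3\,t_4^{2} \\ & - 2^{20}\cdot 3^{4}\cdot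 5^{5}\cdot 13^{4}\cdot 11\,t_2\,t_3\,t_4^{2} \\ & + 2^{8}\cdot 3^{7}\cdot 13^{6}\cdot 5\cdot 1867253\,t_3^{4}\,t_4^{2} \\ & + 2^{22}\cdot 3^{3}\cdot 5^{4}\cdot 13^{2}\cdot 43\cdot 61\,t_1\,t_4^{3} \\ & - 2^{25}\cdot 3^{3}\cdot 5^{5}\cdot 11\cdot 13\cdot 701\,t_2\,t_4^{3} \\ & + 2^{13}\cdot 3^{6}\cdot 13^{5}\cdot 5\cdot 1939033\,t_3^{3}\,t_4^{3} \\ & - 2^{16}\cdot 3^{7}\cdot 13^{4}\cdot 5\cdot 23\cdot 206351\,t_3^{2}\,t_4^{4} \\ & - 2^{22}\cdot 3^{7}\cdot 13^{3}\cdot 19\cdot 71\cdot 2383\,t_3\,t_4^{5} \\ & + 2^{25}\cdot 3^{6}\cdot 13^{2}\cdot 31\cdot 1773679\,t_4^{6}, \end{align*} \begin{align*} B_1 = {}& -2^{12}\cdot 3^{6}\cdot 5^{6}\cdot 13^{3}\cdot 41\,t_2\,t_3^{2} \\ & + 2^{2}\cdot 3^{9}\cdot 5^{2}\cdot 11^{2}\cdot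 13^{8}\,t_3^{5} \\ & - 2^{17}\cdot 3^{6}\cdot 5^{6}\cdot 13^{2}\cdot 23\,t_2\,t_3\,t_4 \\ & + 2^{6}\cdot 3^{9}\cdot 5^{3}\cdot 13^{6}\cdot 43^{2}\,t_3^{4}\,t_4 \\ & + 2^{20}\cdot 3^{6}\cdot 5^{6}\cdot 13\cdot 31\,t_2\,t_4^{2} \\ & + 2^{11}\cdot 3^{9}\cdot 5^{3}\cdot 13^{5}\cdot 757\,t_3^{3}\,t_4^{2} \\ & - 2^{13}\cdot 3^{9}\cdot 5^{3}\cdot 13^{4}\cdot 9431\,t_3^{2}\,t_4^{3} \\ & - 2^{22}\cdot 3^{9}\cdot 5^{3}\cdot 13^{3}\cdot 587\,t_3\,t_4^{4} \\ & - 2^{21}\cdot 3^{9}\cdot 5^{2}\cdot 13^{3}\cdot 17\cdot 257\,t_4^{5}, \end{align*} \begin{align*} B_2 = {}& 2^{14}\cdot 3^{6}\cdot 5^{8}\cdot 13^{2}\,t_2\,t_3 - 2^{2}\cdot 3^{9}\cdot 5^{4}\cdot 13^{6}\cdot 41\,t_3^{4} \\ & + 2^{18}\cdot 3^{7}\cdot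 5^{8}\cdot 13\,t_2\,t_4 \\ & - 2^{8}\cdot 3^{10}\cdot 5^{4}\cdot 13^{5}\cdot 41\,t_3^{3}\,t_4 \\ & - 2^{11}\cdot 3^{10}\cdot 5^{4}\cdot 13^{4}\cdot 269\,t_3^{2}\,t_4^{2} \\ & - 2^{15}\cdot 3^{9}\cdot 5^{4}\cdot 13^{3}\cdot 1039\,t_3\,t_4^{3} \\ & - 2^{18}\cdot 3^{10}\cdot 5^{4}\cdot 13^{2}\cdot 557\,t_4^{4}, \end{align*} and \begin{align*} y_2 = {}& \frac{1}{2^{12}\cdot 3^{5}\cdot 5^{4}\cdot 13}\,\bigl(-2^{12}\cdot 5^{6}\cdot 3\,t_2\,Z \\ & + 2^{13}\cdot 5^{4}\cdot 13^{2}\,t_1\,t_3 - 2^{13}\cdot 5^{4}\cdot 7\cdot 13\,t_2\,t_3 \\ & + 2^{2}\cdot 3^{5}\cdot 5^{4}\cdot 13^{3}\,t_3^{2}\,Z^{2} \\ & + 2^{2}\cdot 3^{4}\cdot 5^{2}\cdot 13^{4}\cdot 41\,t_3^{3}\,Z + 3^{3}\cdot 13^{5}\cdot 11\cdot 1171\,t_3^{4}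 \\ & + 2^{17}\cdot 5^{4}\cdot 13\,t_1\,t_4 - 2^{17}\cdot 5^{6}\,t_2\,t_4 \\ & + 2^{7}\cdot 3^{6}\cdot 5^{4}\cdot 13^{2}\,t_3\,t_4\,Z^{2} \\ & + 2^{6}\cdot 3^{5}\cdot 5^{2}\cdot 13^{3}\cdot 73\,t_3^{2}\,t_4\,Z \\ & + 2^{6}\cdot 3^{3}\cdot 13^{4}\cdot 17\cdot 79\,t_3^{3}\,t_4 \\ & + 2^{10}\cdot 3^{7}\cdot 5^{4}\cdot 13\,t_4^{2}\,Z^{2} \\ & + 2^{10}\cdot 3^{6}\cdot 5^{2}\cdot 13^{2}\cdot 23\,t_3\,t_4^{2}\,Z \\ & - 2^{9}\cdot 3^{4}\cdot 13^{3}\cdot 47\cdot 593\,t_3^{2}\,t_4^{2} \\ & + 2^{13}\cdot 3^{4}\cdot 5^{2}\cdot 13\cdot 139\,t_4^{3}\,Z \\ & - 2^{15}\cdot 3^{3}\cdot 13^{2}\cdot 23\cdot 1303\,t_3\,t_4^{3} \\ & - 2^{16}\cdot 3^{3}\cdot 13\cdot 62539\,t_4^{4}\bigr), \end{align*} \begin{align*}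 y_3 = {}& \frac{1}{2^{4}\cdot 3^{4}\cdot 5\cdot 13}\,\bigl(-2^{5}\cdot 5\cdot 13\,t_1 + 2^{9}\cdot 3\cdot 5\,t_2 \\ & + 3^{3}\cdot 13^{4}\,t_3^{3} + 2^{4}\cdot 3^{5}\cdot 13^{3}\,t_3^{2}\,t_4 \\ & + 2^{6}\cdot 3^{4}\cdot 13^{2}\cdot 11\,t_3\,t_4^{2} - 2^{9}\cdot 3^{3}\cdot 13\cdot 79\,t_4^{3}\bigr), \end{align*} and $y_4=12t_4$. Then, for all $t\in U$ and all $i,j\in\{1,2,3,4\}$, the tensorial transformation of the intersection form under $y=y(t)$ is the $F_4$ Saito form: $$g^{\lambda\mu}(t)\,\frac{\partial y_i}{\partial t_\lambda}\frac{\partial y_j}{\partial t_\mu}=G^{ij}\bigl(y_1(t),y_2(t),y_3(t),y_4(t)\bigr),$$ where the derivatives are total derivatives along the branch $Z(t)$. -/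

import Mathlib

/-! The Frobenius manifold of type `F_4(a_2)` and the intersection form of `F_4`. -/

noncomputable section

namespace F4a2

/-- The partial derivative `∂f/∂z_i` of a function on `ℂ⁴`. -/
def pd (i : Fin 4) (f : (Fin 4 → ℂ) → ℂ) (z : Fin 4 → ℂ) : ℂ :=
  fderiv ℂ f z (Pi.single i 1)

/-- The cubic polynomial `P(t₂, t₃, t₄, Z)`. -/
def cubic (t2 t3 t4 Z : ℂ) : ℂ :=
  Z^3 - ((2^3 * 3^4 * 13) / 5^4) * (((2^3 * 3) / 13) * t4^2 + t4 * t3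
      + (13 / (2^5 * 3)) * t3^2) * Z
      + ((2^2 * 3 * 13) / 5^6) * (((2^6 * 5^4) / (3^3 * 13^2)) * t2 - ((2^7 * 139) / 13) * t4^3
      - 2^4 * 3^2 * 23 * t4^2 * t3 - 3 * 13 * 73 * t4 * t3^2 - ((13^2 * 41) / 2^4) * t3^3)

/-- The coefficient of `Z²` in the prepotential. -/
def prepotentialCoeff2 (t2 t3 t4 : ℂ) : ℂ :=
  ((3^14 * 139) / (5^5 * 2 * 7)) * t4^5 + ((3^13 * 13 * 19) / (5^4 * 2 * 7)) * t4^4 * t3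
  + ((3^15 * 13^3) / (2^11 * 5^4)) * t4^2 * t3^3
  + ((3^12 * 13^3 * 101) / (2^9 * 5^4 * 7)) * t4^3 * t3^2
  + ((3^13 * 13^4 * 31) / (2^16 * 5^4 * 7)) * t4 * t3^4
  + ((3^12 * 13^5 * 41) / (2^20 * 5^5 * 7)) * t3^5 - (3^11 / (2^2 * 5 * 7 * 13)) * t4^2 * t2
  - (3^10 / (2^5 * 5 * 7)) * t4 * t3 * t2 - ((3^9 * 13) / (2^10 * 5 * 7)) * t3^2 * t2

/-- The coefficient of `Z` in the prepotential. -/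
def prepotentialCoeff1 (t2 t3 t4 : ℂ) : ℂ :=
  ((2^2 * 3^9 * 89 * 11701) / (5^7 * 7)) * t4^6
  + ((3^11 * 13 * 68473) / (5^7 * 7)) * t4^5 * t3
  + ((3^10 * 13^3 * 1949) / (2^3 * 5^6 * 7)) * t4^4 * t3^2
  + ((3^9 * 13^3 * 131357) / (2^8 * 5^6 * 7)) * t4^3 * t3^3
  + ((3^12 * 13^4 * 2729) / (2^12 * 5^6 * 7)) * t4^2 * t3^4
  + ((3^10 * 13^5 * 15937) / (2^15 * 5^7 * 7)) * t4 * t3^5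
  + ((3^9 * 13^6 * 29 * 43) / (2^20 * 5^7)) * t3^6 + ((3^3 * 5^2) / (13^2 * 7)) * t2^2
  - ((2^2 * 3^6 * 139) / (5^2 * 7 * 13)) * t4^3 * t2
  - ((3^8 * 23) / (5^2 * 2 * 7)) * t4^2 * t3 * t2
  - ((3^7 * 13 * 73) / (2^5 * 5^2 * 7)) * t4 * t3^2 * t2
  - ((3^6 * 13^2 * 41) / (2^9 * 5^2 * 7)) * t3^3 * t2

/-- The part of the prepotential free of `Z`. -/
def prepotentialCoeff0 (t1 t2 t3 t4 : ℂ) : ℂ :=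
  ((2^5 * 3^7 * 67 * 521749) / (5^9 * 7)) * t4^7
  + ((2^4 * 3^10 * 13 * 693097) / (5^9 * 7)) * t4^6 * t3
  + ((2^2 * 3^8 * 13^2 * 23^2 * 7 * 97) / 5^9) * t4^5 * t3^2
  + ((3^7 * 13^3 * 18224639) / (2^6 * 5^8 * 7)) * t4^4 * t3^3
  + ((3^8 * 13^4 * 7243667) / (2^11 * 5^8 * 7)) * t4^3 * t3^4
  + ((3^8 * 13^5 * 8754721) / (2^14 * 5^9 * 7)) * t4^2 * t3^5
  + ((3^7 * 13^6 * 19 * 435503) / (2^18 * 5^9 * 7)) * t4 * t3^6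
  + ((3^8 * 13^7 * 41 * 7129) / (2^22 * 5^9 * 7)) * t3^7
  + ((2^4 * 3^4 * 71 * 4259) / (5^5 * 7 * 13)) * t4^4 * t2
  - ((2^3 * 3^4 * 23 * 47) / (5^5 * 7)) * t4^3 * t3 * t2
  - ((3^5 * 13 * 103 * 293) / (2^3 * 5^5 * 7)) * t4^2 * t3^2 * t2
  - ((3^4 * 13^2 * 79 * 467) / (2^6 * 5^5 * 7)) * t4 * t3^3 * t2
  - ((3^4 * 13^3 * 157 * 383) / (2^12 * 5^5 * 7)) * t3^4 * t2 + (2^4 / 13^2) * t4 * t2^2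
  - (7 / 13) * t3 * t2^2 + t3 * t2 * t1 + ((t4 * t1^2) / 2)

/-- The prepotential as a polynomial in the independent variables `t₁, t₂, t₃, t₄, Z`. -/
def prepotentialPoly (t1 t2 t3 t4 Z : ℂ) : ℂ :=
  prepotentialCoeff0 t1 t2 t3 t4 + prepotentialCoeff2 t2 t3 t4 * Z^2
    + prepotentialCoeff1 t2 t3 t4 * Z

/-- The prepotential as a function of the flat coordinates, for a branch `Z` of the root. -/
def prepotential (Z : (Fin 4 → ℂ) → ℂ) (t : Fin 4 → ℂ) : ℂ :=
  prepotentialPoly (t 0) (t 1) (t 2) (t 3) (Z t)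

/-- `c_{ijk} = ∂³F / ∂t_i ∂t_j ∂t_k`. -/
def cLow (F : (Fin 4 → ℂ) → ℂ) (i j k : Fin 4) (t : Fin 4 → ℂ) : ℂ :=
  pd i (pd j (pd k F)) t

/-- `η_{ij} = ∂³F / ∂t_i ∂t_j ∂t_1` (the unity field is `∂/∂t_1`). -/
def eta (F : (Fin 4 → ℂ) → ℂ) (t : Fin 4 → ℂ) : Matrix (Fin 4) (Fin 4) ℂ :=
  Matrix.of fun i j => cLow F i j 0 t

/-- `c^{ij}_k = η^{iα} η^{jβ} c_{αβk}`. -/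
def cUp (F : (Fin 4 → ℂ) → ℂ) (i j k : Fin 4) (t : Fin 4 → ℂ) : ℂ :=
  ∑ α, ∑ β, (eta F t)⁻¹ i α * (eta F t)⁻¹ j β * cLow F α β k t

/-- The Euler vector field `t₁∂₁ + t₂∂₂ + ⅓t₃∂₃ + ⅓t₄∂₄`. -/
def euler (t : Fin 4 → ℂ) : Fin 4 → ℂ :=
  ![t 0, t 1, 1 / 3 * t 2, 1 / 3 * t 3]

/-- The intersection form `g^{ij} = E^λ c^{ij}_λ` in the `t` coordinates. -/
def intersectionForm (F : (Fin 4 → ℂ) → ℂ) (t : Fin 4 → ℂ) : Matrix (Fin 4) (Fin 4) ℂ :=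
  Matrix.of fun i j => ∑ l, euler t l * cUp F i j l t

/-- The tensorial transformation of a `(2,0)`-tensor field `g` under `y = y(z)`, at the point `z`:
`g^{λμ}(z) (∂y_i/∂z_λ) (∂y_j/∂z_μ)`. -/
def transform (g : (Fin 4 → ℂ) → Matrix (Fin 4) (Fin 4) ℂ) (y : Fin 4 → (Fin 4 → ℂ) → ℂ)
    (z : Fin 4 → ℂ) : Matrix (Fin 4) (Fin 4) ℂ :=
  Matrix.of fun i j => ∑ l, ∑ m, g z l m * pd l (y i) z * pd m (y j) z

def eps1 (x : Fin 4 → ℂ) : ℂ := x 0 ^ 2 + x 1 ^ 2 + x 2 ^ 2 + x 3 ^ 2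

def eps2 (x : Fin 4 → ℂ) : ℂ :=
  x 0 ^ 2 * x 1 ^ 2 + x 0 ^ 2 * x 2 ^ 2 + x 0 ^ 2 * x 3 ^ 2 + x 1 ^ 2 * x 2 ^ 2
    + x 1 ^ 2 * x 3 ^ 2 + x 2 ^ 2 * x 3 ^ 2

def eps3 (x : Fin 4 → ℂ) : ℂ :=
  x 0 ^ 2 * x 1 ^ 2 * x 2 ^ 2 + x 0 ^ 2 * x 1 ^ 2 * x 3 ^ 2 + x 0 ^ 2 * x 2 ^ 2 * x 3 ^ 2
    + x 1 ^ 2 * x 2 ^ 2 * x 3 ^ 2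

def eps4 (x : Fin 4 → ℂ) : ℂ := x 0 ^ 2 * x 1 ^ 2 * x 2 ^ 2 * x 3 ^ 2

/-- The basic invariants `y₁, y₂, y₃, y₄` of `F_4` as polynomials in the orthonormal
coordinates `x`. -/
def invariants : Fin 4 → (Fin 4 → ℂ) → ℂ :=
  ![fun x => 288 * eps2 x * eps4 x - 108 * eps1 x ^ 2 * eps4 x - 8 * eps2 x ^ 3
      + 3 * eps1 x ^ 2 * eps2 x ^ 2,
    fun x => 12 * eps4 x - 3 * eps1 x * eps3 x + eps2 x ^ 2,
    fun x => 6 * eps3 x - eps1 x * eps2 x,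
    fun x => eps1 x]

/-- The intersection form of `F_4` in the basic invariants `y₁, y₂, y₃, y₄`. -/
def saitoForm (y1 y2 y3 y4 : ℂ) : Matrix (Fin 4) (Fin 4) ℂ :=
  let g11 := 1152 * y2^2 * y3 - 144 * y1 * y2 * y4 + 1152 * y2 * y3^2 * y4
    - 144 * y1 * y3 * y4^2 + 288 * y3^3 * y4^2
  let g12 := -96 * y2^2 * y4 - 48 * y2 * y3 * y4^2
  let g13 := 192 * y2^2 + 120 * y2 * y3 * y4 - 12 * y1 * y4^2 + 12 * y3^2 * y4^2
  let g14 := 24 * y1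
  let g22 := -8 * y2 * y3 - y1 * y4 + 3 * y3^2 * y4
  let g23 := 2 * y1 - 6 * y3^2 - 8 * y2 * y4^2
  let g24 := 16 * y2
  let g33 := 20 * y2 * y4 - 4 * y3 * y4^2
  let g34 := 12 * y3
  let g44 := 4 * y4
  !![g11, g12, g13, g14;
     g12, g22, g23, g24;
     g13, g23, g33, g34;
     g14, g24, g34, g44]

/-- The coefficient of `Z²` in the bracket of `y₁`. -/
def y1Coeff2 (t2 t3 t4 : ℂ) : ℂ :=
  2^14 * 3^6 * 5^8 * 13^2 * t2 * t3 - 2^2 * 3^9 * 5^4 * 13^6 * 41 * t3^4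
  + 2^18 * 3^7 * 5^8 * 13 * t2 * t4 - 2^8 * 3^10 * 5^4 * 13^5 * 41 * t3^3 * t4
  - 2^11 * 3^10 * 5^4 * 13^4 * 269 * t3^2 * t4^2 - 2^15 * 3^9 * 5^4 * 13^3 * 1039 * t3 * t4^3
  - 2^18 * 3^10 * 5^4 * 13^2 * 557 * t4^4

/-- The coefficient of `Z` in the bracket of `y₁`. -/
def y1Coeff1 (t2 t3 t4 : ℂ) : ℂ :=
  -2^12 * 3^6 * 5^6 * 13^3 * 41 * t2 * t3^2 + 2^2 * 3^9 * 5^2 * 11^2 * 13^8 * t3^5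
  - 2^17 * 3^6 * 5^6 * 13^2 * 23 * t2 * t3 * t4 + 2^6 * 3^9 * 5^3 * 13^6 * 43^2 * t3^4 * t4
  + 2^20 * 3^6 * 5^6 * 13 * 31 * t2 * t4^2 + 2^11 * 3^9 * 5^3 * 13^5 * 757 * t3^3 * t4^2
  - 2^13 * 3^9 * 5^3 * 13^4 * 9431 * t3^2 * t4^3 - 2^22 * 3^9 * 5^3 * 13^3 * 587 * t3 * t4^4
  - 2^21 * 3^9 * 5^2 * 13^3 * 17 * 257 * t4^5

/-- The part of the bracket of `y₁` free of `Z`. -/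
def y1Coeff0 (t1 t2 t3 t4 : ℂ) : ℂ :=
  2^17 * 5^8 * 13^2 * t1^2 - 2^22 * 5^8 * 13 * t1 * t2 + 2^22 * 5^8 * 17 * t2^2
  + 2^13 * 3^3 * 5^4 * 13^5 * 7 * 29 * t1 * t3^3 - 2^12 * 3^3 * 5^5 * 13^4 * 491 * t2 * t3^3
  + 3^6 * 13^8 * 1202837 * t3^6 + 2^17 * 3^4 * 5^4 * 13^4 * 59 * t1 * t3^2 * t4
  + 2^16 * 3^4 * 5^5 * 13^3 * 67 * t2 * t3^2 * t4 + 2^5 * 3^7 * 13^8 * 111347 * t3^5 * t4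
  - 2^19 * 3^4 * 5^4 * 13^3 * 367 * t1 * t3 * t4^2
  - 2^20 * 3^4 * 5^5 * 13^4 * 11 * t2 * t3 * t4^2
  + 2^8 * 3^7 * 13^6 * 5 * 1867253 * t3^4 * t4^2
  + 2^22 * 3^3 * 5^4 * 13^2 * 43 * 61 * t1 * t4^3
  - 2^25 * 3^3 * 5^5 * 11 * 13 * 701 * t2 * t4^3
  + 2^13 * 3^6 * 13^5 * 5 * 1939033 * t3^3 * t4^3
  - 2^16 * 3^7 * 13^4 * 5 * 23 * 206351 * t3^2 * t4^4
  - 2^22 * 3^7 * 13^3 * 19 * 71 * 2383 * t3 * t4^5 + 2^25 * 3^6 * 13^2 * 31 * 1773679 * t4^6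

def y1Poly (t1 t2 t3 t4 Z : ℂ) : ℂ :=
  (1 / (2^15 * 3^9 * 5^6 * 13^2)) *
    (y1Coeff0 t1 t2 t3 t4 + y1Coeff2 t2 t3 t4 * Z^2 + y1Coeff1 t2 t3 t4 * Z)

def y2Poly (t1 t2 t3 t4 Z : ℂ) : ℂ :=
    (1 / (2^12 * 3^5 * 5^4 * 13)) * (-2^12 * 5^6 * 3 * t2 * Z + 2^13 * 5^4 * 13^2 * t1 * t3
      - 2^13 * 5^4 * 7 * 13 * t2 * t3 + 2^2 * 3^5 * 5^4 * 13^3 * t3^2 * Z^2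
      + 2^2 * 3^4 * 5^2 * 13^4 * 41 * t3^3 * Z + 3^3 * 13^5 * 11 * 1171 * t3^4
      + 2^17 * 5^4 * 13 * t1 * t4 - 2^17 * 5^6 * t2 * t4
      + 2^7 * 3^6 * 5^4 * 13^2 * t3 * t4 * Z^2 + 2^6 * 3^5 * 5^2 * 13^3 * 73 * t3^2 * t4 * Z
      + 2^6 * 3^3 * 13^4 * 17 * 79 * t3^3 * t4 + 2^10 * 3^7 * 5^4 * 13 * t4^2 * Z^2
      + 2^10 * 3^6 * 5^2 * 13^2 * 23 * t3 * t4^2 * Z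
      - 2^9 * 3^4 * 13^3 * 47 * 593 * t3^2 * t4^2 + 2^13 * 3^4 * 5^2 * 13 * 139 * t4^3 * Z
      - 2^15 * 3^3 * 13^2 * 23 * 1303 * t3 * t4^3 - 2^16 * 3^3 * 13 * 62539 * t4^4)

def y3Poly (t1 t2 t3 t4 : ℂ) : ℂ :=
    (1 / (2^4 * 3^4 * 5 * 13)) * (-2^5 * 5 * 13 * t1 + 2^9 * 3 * 5 * t2 + 3^3 * 13^4 * t3^3
      + 2^4 * 3^5 * 13^3 * t3^2 * t4 + 2^6 * 3^4 * 13^2 * 11 * t3 * t4^2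
      - 2^9 * 3^3 * 13 * 79 * t4^3)

def y4Poly (t4 : ℂ) : ℂ := 12 * t4

/-- The functions `y₁, y₂, y₃, y₄` of the flat coordinates `t`, for a branch `Z` of the root. -/
def yFlat (Z : (Fin 4 → ℂ) → ℂ) : Fin 4 → (Fin 4 → ℂ) → ℂ :=
  ![fun t => y1Poly (t 0) (t 1) (t 2) (t 3) (Z t),
    fun t => y2Poly (t 0) (t 1) (t 2) (t 3) (Z t),
    fun t => y3Poly (t 0) (t 1) (t 2) (t 3),
    fun t => y4Poly (t 3)]

end F4a2

end

noncomputable section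

namespace F4a2

/-! Both claims reduce to one shape, `J * g * Jᵀ`, followed by polynomial identities checked by
`ring`.

For the orthonormal coordinates the Jacobian factors through the elementary symmetric functions ε of
the squares, `J = N * E`. The Gram matrix `E * Eᵀ` is a polynomial in the ε alone, so `N * (E * Eᵀ)
* Nᵀ` can be compared with the Saito form over independent ε₁, …, ε₄.

For the flat coordinates the obstacle is the algebraic function Z. The cubic is linear in t₂ with
constant coefficient, and the coefficient of Z is a constant times the square of a linear form in
t₃, t₄. In the scaled variables u, z, with T = t₁ and b = t₄, t₂ becomes a polynomial whose
z-derivative is a constant times u² - z². The z-derivatives of F and of its flat gradient are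
multiples of that same factor, so the flat gradient and Hessian of F are polynomials in T, u, b, z;
so is the flat Jacobian of the yᵢ. These polynomials are supplied explicitly and verified by the
chain rule without dividing by u² - z².

Third derivatives would bring in u² - z² as a denominator, but are never computed. F is
quasi-homogeneous of degree 7/3 for the weights d = (1, 1, 1/3, 1/3), so Σ E^l F_{jl} = (7/3 - d_j)
F_j. Differentiating along t_i gives Σ E^l c_{ijl} = (7/3 - d_i - d_j) F_{ij}. The metric η is the
constant exchange matrix, so raising indices only reverses them, and the intersection form is a
weighted, reversed Hessian (`intersectionForm_prepotential`). What remains is an identity in four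
free variables, `branchJac_mul_branchForm`. -/

/-- `f` is differentiable at `t` with derivative `d` in the direction `v`. -/
structure HasDir (v : Fin 4 → ℂ) (f : (Fin 4 → ℂ) → ℂ) (t : Fin 4 → ℂ) (d : ℂ) : Prop where
  differentiableAt : DifferentiableAt ℂ f t
  fderiv_apply : fderiv ℂ f t v = d

/-! ### Calculus of directional derivatives -/

namespace HasDir

variable {v t : Fin 4 → ℂ} {f g : (Fin 4 → ℂ) → ℂ} {a b : ℂ}

theorem of_eq (h : HasDir v f t a) (e : a = b) : HasDir v f t b := e ▸ h

theorem unique (hf : HasDir v f t a) (hg : HasDir v f t b) : a = b :=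
  hf.fderiv_apply.symm.trans hg.fderiv_apply

theorem congr_of_eventuallyEq (hf : HasDir v f t a) (h : g =ᶠ[nhds t] f) : HasDir v g t a :=
  ⟨hf.1.congr_of_eventuallyEq h, by rw [h.fderiv_eq, hf.2]⟩

theorem const (c : ℂ) : HasDir v (fun _ => c) t 0 :=
  ⟨differentiableAt_const c, by simp⟩

theorem coord (k : Fin 4) : HasDir v (fun s => s k) t (v k) :=
  ⟨differentiableAt_apply k t, by
    have h : HasFDerivAt (fun s : Fin 4 → ℂ => s k)
      (ContinuousLinearMap.proj (R := ℂ) (φ := fun _ : Fin 4 => ℂ) k) t := hasFDerivAt_apply k t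
    rw [h.fderiv]; rfl⟩

theorem add (hf : HasDir v f t a) (hg : HasDir v g t b) :
    HasDir v (fun s => f s + g s) t (a + b) :=
  ⟨hf.1.add hg.1, by rw [fderiv_fun_add hf.1 hg.1]; simp [hf.2, hg.2]⟩

theorem sub (hf : HasDir v f t a) (hg : HasDir v g t b) :
    HasDir v (fun s => f s - g s) t (a - b) :=
  ⟨hf.1.sub hg.1, by rw [fderiv_fun_sub hf.1 hg.1]; simp [hf.2, hg.2]⟩

theorem mul (hf : HasDir v f t a) (hg : HasDir v g t b) :
    HasDir v (fun s => f s * g s) t (a * g t + f t * b) :=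
  ⟨hf.1.mul hg.1, by rw [fderiv_fun_mul hf.1 hg.1]; simp [hf.2, hg.2]; ring⟩

theorem pow (hf : HasDir v f t a) (n : ℕ) :
    HasDir v (fun s => f s ^ n) t (n * f t ^ (n - 1) * a) :=
  ⟨hf.1.pow n, by rw [fderiv_fun_pow n hf.1]; simp [hf.2]⟩

theorem sum {ι : Type*} {s : Finset ι} {F : ι → (Fin 4 → ℂ) → ℂ} {d : ι → ℂ}
    (h : ∀ i ∈ s, HasDir v (F i) t (d i)) :
    HasDir v (fun x => ∑ i ∈ s, F i x) t (∑ i ∈ s, d i) :=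
  ⟨DifferentiableAt.fun_sum fun i hi => (h i hi).1, by
    rw [fderiv_fun_sum fun i hi => (h i hi).1, sum_apply]
    exact Finset.sum_congr rfl fun i hi => (h i hi).2⟩

theorem of_differentiableAt (h : DifferentiableAt ℂ f t) : HasDir v f t (fderiv ℂ f t v) :=
  ⟨h, rfl⟩

theorem pd_eq {k : Fin 4} (h : HasDir (Pi.single k 1) f t a) : pd k f t = a := h.2

end HasDir

theorem pd_congr {k : Fin 4} {f g : (Fin 4 → ℂ) → ℂ} {t : Fin 4 → ℂ} (h : f =ᶠ[nhds t] g) :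
    pd k f t = pd k g t := by
  rw [pd, pd, h.fderiv_eq]

/-- The transformation of a `(2,0)`-tensor as a product with the Jacobian matrix. -/
theorem transform_eq_mul (g : (Fin 4 → ℂ) → Matrix (Fin 4) (Fin 4) ℂ)
    (y : Fin 4 → (Fin 4 → ℂ) → ℂ) (z : Fin 4 → ℂ) {J : Matrix (Fin 4) (Fin 4) ℂ}
    (hJ : ∀ i l, pd l (y i) z = J i l) :
    transform g y z = J * g z * J.transpose := by
  ext i j
  simp only [transform, Matrix.of_apply, Matrix.mul_apply, Matrix.transpose_apply, hJ,
    Finset.sum_mul]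
  rw [Finset.sum_comm]
  refine Finset.sum_congr rfl fun m _ => Finset.sum_congr rfl fun l _ => ?_
  ring

/-! ### The Saito form in orthonormal coordinates -/

/-- The Jacobian matrix of the elementary symmetric polynomials of the squares. -/
def epsJac (x : Fin 4 → ℂ) : Matrix (Fin 4) (Fin 4) ℂ :=
  !![2 * x 0, 2 * x 1, 2 * x 2, 2 * x 3;
     2 * x 0 * (x 1 ^ 2 + x 2 ^ 2 + x 3 ^ 2), 2 * x 1 * (x 0 ^ 2 + x 2 ^ 2 + x 3 ^ 2),
     2 * x 2 * (x 0 ^ 2 + x 1 ^ 2 + x 3 ^ 2), 2 * x 3 * (x 0 ^ 2 + x 1 ^ 2 + x 2 ^ 2);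
     2 * x 0 * (x 1 ^ 2 * x 2 ^ 2 + x 1 ^ 2 * x 3 ^ 2 + x 2 ^ 2 * x 3 ^ 2),
     2 * x 1 * (x 0 ^ 2 * x 2 ^ 2 + x 0 ^ 2 * x 3 ^ 2 + x 2 ^ 2 * x 3 ^ 2),
     2 * x 2 * (x 0 ^ 2 * x 1 ^ 2 + x 0 ^ 2 * x 3 ^ 2 + x 1 ^ 2 * x 3 ^ 2),
     2 * x 3 * (x 0 ^ 2 * x 1 ^ 2 + x 0 ^ 2 * x 2 ^ 2 + x 1 ^ 2 * x 2 ^ 2);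
     2 * x 0 * (x 1 ^ 2 * x 2 ^ 2 * x 3 ^ 2), 2 * x 1 * (x 0 ^ 2 * x 2 ^ 2 * x 3 ^ 2),
     2 * x 2 * (x 0 ^ 2 * x 1 ^ 2 * x 3 ^ 2), 2 * x 3 * (x 0 ^ 2 * x 1 ^ 2 * x 2 ^ 2)]

/-- The Gram matrix of the gradients of the elementary symmetric polynomials of the squares. -/
def epsGram (e1 e2 e3 e4 : ℂ) : Matrix (Fin 4) (Fin 4) ℂ :=
  !![4 * e1, 8 * e2, 12 * e3, 16 * e4;
     8 * e2, 4 * (e1 * e2 + 3 * e3), 4 * (2 * e1 * e3 + 4 * e4), 12 * e1 * e4;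
     12 * e3, 4 * (2 * e1 * e3 + 4 * e4), 4 * (e2 * e3 + 3 * e1 * e4), 8 * e2 * e4;
     16 * e4, 12 * e1 * e4, 8 * e2 * e4, 4 * e3 * e4]

/-- The Jacobian matrix of the basic invariants with respect to `ε₁, ε₂, ε₃, ε₄`. -/
def invariantsJac (e1 e2 e3 e4 : ℂ) : Matrix (Fin 4) (Fin 4) ℂ :=
  !![-216 * e1 * e4 + 6 * e1 * e2 ^ 2, 288 * e4 - 24 * e2 ^ 2 + 6 * e1 ^ 2 * e2, 0,
       288 * e2 - 108 * e1 ^ 2;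
     -3 * e3, 2 * e2, -3 * e1, 12;
     -e2, -e1, 6, 0;
     1, 0, 0, 0]

/-- The Gram matrix is symmetric in the squares of the coordinates, hence expressible in the ε; this
removes x from the rest of the computation. -/
theorem epsJac_mul_transpose (x : Fin 4 → ℂ) :
    epsJac x * (epsJac x).transpose = epsGram (eps1 x) (eps2 x) (eps3 x) (eps4 x) := by
  ext i j
  fin_cases i <;> fin_cases j <;>
    simp [epsJac, epsGram, Matrix.mul_apply, Fin.sum_univ_four, eps1, eps2, eps3, eps4] <;> ring

theorem hasDir_eps1 (v x : Fin 4 → ℂ) : HasDir v eps1 x ((epsJac x).mulVec v 0) := by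
  unfold eps1
  apply HasDir.of_eq
  · repeat' first
      | exact HasDir.coord _ | exact HasDir.const _ | apply HasDir.add | apply HasDir.pow
  · simp [epsJac, Matrix.mulVec, dotProduct, Fin.sum_univ_four]

theorem hasDir_eps2 (v x : Fin 4 → ℂ) : HasDir v eps2 x ((epsJac x).mulVec v 1) := by
  unfold eps2
  apply HasDir.of_eq
  · repeat' first
      | exact HasDir.coord _ | exact HasDir.const _ | apply HasDir.add | apply HasDir.pow
      | apply HasDir.mul
  · simp [epsJac, Matrix.mulVec, dotProduct, Fin.sum_univ_four]; ring

theorem hasDir_eps3 (v x : Fin 4 → ℂ) : HasDir v eps3 x ((epsJac x).mulVec v 2) := by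
  unfold eps3
  apply HasDir.of_eq
  · repeat' first
      | exact HasDir.coord _ | exact HasDir.const _ | apply HasDir.add | apply HasDir.pow
      | apply HasDir.mul
  · simp [epsJac, Matrix.mulVec, dotProduct, Fin.sum_univ_four]; ring

theorem hasDir_eps4 (v x : Fin 4 → ℂ) : HasDir v eps4 x ((epsJac x).mulVec v 3) := by
  unfold eps4
  apply HasDir.of_eq
  · repeat' first
      | exact HasDir.coord _ | exact HasDir.const _ | apply HasDir.add | apply HasDir.pow
      | apply HasDir.mul
  · simp [epsJac, Matrix.mulVec, dotProduct, Fin.sum_univ_four]; ring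

theorem hasDir_invariants (v x : Fin 4 → ℂ) (i : Fin 4) :
    HasDir v (invariants i) x
      ((invariantsJac (eps1 x) (eps2 x) (eps3 x) (eps4 x)).mulVec ((epsJac x).mulVec v) i) := by
  have h1 := hasDir_eps1 v x
  have h2 := hasDir_eps2 v x
  have h3 := hasDir_eps3 v x
  have h4 := hasDir_eps4 v x
  -- Only the chain rule through the ε matters here, so their derivatives become an arbitrary
  -- vector.
  generalize (epsJac x).mulVec v = d at *
  fin_cases i <;> simp only [invariants] <;> dsimp only [Fin.zero_eta, Fin.mk_one,
      Fin.reduceFinMk, Matrix.cons_val] <;> apply HasDir.of_eq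
  any_goals repeat' first
    | exact h1 | exact h2 | exact h3 | exact h4 | exact HasDir.const _ | apply HasDir.add
    | apply HasDir.sub | apply HasDir.pow | apply HasDir.mul
  all_goals
    simp [invariantsJac, Matrix.mulVec, dotProduct, Fin.sum_univ_four] <;> ring

theorem invariantsJac_mul_epsGram (e1 e2 e3 e4 : ℂ) :
    invariantsJac e1 e2 e3 e4 * epsGram e1 e2 e3 e4 * (invariantsJac e1 e2 e3 e4).transpose =
      saitoForm (288 * e2 * e4 - 108 * e1 ^ 2 * e4 - 8 * e2 ^ 3 + 3 * e1 ^ 2 * e2 ^ 2)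
        (12 * e4 - 3 * e1 * e3 + e2 ^ 2) (6 * e3 - e1 * e2) e1 := by
  ext i j
  fin_cases i <;> fin_cases j <;>
    simp [invariantsJac, epsGram, saitoForm, Matrix.mul_apply, Fin.sum_univ_four] <;> ring

theorem transform_one_invariants (x : Fin 4 → ℂ) :
    transform (fun _ => 1) invariants x =
      saitoForm (invariants 0 x) (invariants 1 x) (invariants 2 x) (invariants 3 x) := by
  set N := invariantsJac (eps1 x) (eps2 x) (eps3 x) (eps4 x) with hN
  have hJ : ∀ i l, pd l (invariants i) x = (N * epsJac x) i l := by
    intro i l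
    rw [(hasDir_invariants _ x i).pd_eq, Matrix.mulVec_mulVec, Matrix.mulVec_single_one]
    rfl
  rw [transform_eq_mul _ _ _ hJ, mul_one, Matrix.transpose_mul, Matrix.mul_assoc,
    ← Matrix.mul_assoc (epsJac x), epsJac_mul_transpose, ← Matrix.mul_assoc, hN,
    invariantsJac_mul_epsGram]
  rfl

/-! ### Coordinates in which the discriminant of the cubic factors

On a branch, `t₂` is a cubic polynomial in `t₃, t₄, Z`, so that `T = t₁`, `b = t₄`,
`u = (39 t₃ + 144 t₄) / 80` and `z = 5 Z / 8` are coordinates; the derivative of the cubic is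
a multiple of `u² - z²`. -/

/-- The coordinate `u = (39 t₃ + 144 t₄) / 80`. -/
def uCoord (t : Fin 4 → ℂ) : ℂ := 39 / 80 * t 2 + 9 / 5 * t 3

/-- The flat coordinate `t₃` in terms of `u, b`. -/
def branchT3 (u b : ℂ) : ℂ := 16 / 39 * (5 * u - 9 * b)

/-- The flat coordinate `t₂` in terms of `u, b, z`. -/
def branchT2 (u b z : ℂ) : ℂ :=
  26 / 5 * (82 * u^3 - 180 * u^2 * b + 27 * u^2 * z + 135 * b^3 - 9 * z^3)

/-- The prepotential in the coordinates `T, u, b, z`. -/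
def branchPotential (T u b z : ℂ) : ℂ :=
  1 / 1050 * (525 * T^2 * b + 918400 * T * u^4 - 3669120 * T * u^3 * b + 302400 * T * u^3 * z +
    3628800 * T * u^2 * b^2 - 544320 * T * u^2 * b * z + 1512000 * T * u * b^3 - 100800 * T * u
    * z^3 - 2721600 * T * b^4 + 181440 * T * b * z^3 - 820850176 * u^7 + 6487563264 * u^6 * b -
    443862720 * u^6 * z - 20615454720 * u^5 * b^2 + 2352043008 * u^5 * b * z - 22861440 * u^5 *
    z^2 + 33743001600 * u^4 * b^3 - 4493905920 * u^4 * b^2 * z + 43110144 * u^4 * b * z^2 +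
    157752000 * u^4 * z^3 - 28410600960 * u^3 * b^4 + 3788467200 * u^3 * b^3 * z - 784014336 *
    u^3 * b * z^3 + 15240960 * u^3 * z^4 + 8883302400 * u^2 * b^5 - 1038562560 * u^2 * b^4 * z +
    1497968640 * u^2 * b^2 * z^3 - 28740096 * u^2 * b * z^4 - 8817984 * u^2 * z^5 + 1437004800 *
    u * b^6 - 1262822400 * u * b^3 * z^3 - 2540160 * u * z^6 - 341521920 * b^7 + 346187520 * b^4
    * z^3 + 4790016 * b * z^6 + 2099520 * z^7)

/-- The derivative `∂F/∂t_1` in the coordinates `T, u, b, z`. -/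
def branchGrad1 (T u b z : ℂ) : ℂ :=
  1 / 15 * (15 * T * b + 13120 * u^4 - 52416 * u^3 * b + 4320 * u^3 * z + 51840 * u^2 * b^2 -
    7776 * u^2 * b * z + 21600 * u * b^3 - 1440 * u * z^3 - 38880 * b^4 + 2592 * b * z^3)

/-- The derivative `∂F/∂t_2` in the coordinates `T, u, b, z`. -/
def branchGrad2 (T u b z : ℂ) : ℂ :=
  16 / 195 * (25 * T * u - 45 * T * b - 36695 * u^4 + 194448 * u^3 * b - 3780 * u^3 * z - 371520
    * u^2 * b^2 + 7128 * u^2 * b * z + 2430 * u^2 * z^2 + 313200 * u * b^3 + 1260 * u * z^3 -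
    85860 * b^4 - 2376 * b * z^3 - 1215 * z^4)

/-- The derivative `∂F/∂t_3` in the coordinates `T, u, b, z`. -/
def branchGrad3 (T u b z : ℂ) : ℂ :=
  26 / 125 * (2050 * T * u^3 - 4500 * T * u^2 * b + 675 * T * u^2 * z + 3375 * T * b^3 - 225 * T
    * z^3 - 3798814 * u^6 + 25842600 * u^5 * b - 3033180 * u^5 * z - 68688000 * u^4 * b^2 +
    12636000 * u^4 * b * z - 648810 * u^4 * z^2 + 90482400 * u^3 * b^3 - 17496000 * u^3 * b^2 *
    z + 874800 * u^3 * b * z^2 + 967320 * u^3 * z^3 - 56376000 * u^2 * b^4 + 8456400 * u^2 * b^3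
    * z - 4212000 * u^2 * b * z^3 + 332910 * u^2 * z^4 + 8748000 * u * b^5 + 5832000 * u * b^2 *
    z^3 - 437400 * u * b * z^4 + 26244 * u * z^5 + 3207600 * b^6 - 2818800 * b^3 * z^3 - 5670 *
    z^6)

/-- The derivative `∂F/∂t_4` in the coordinates `T, u, b, z`. -/
def branchGrad4 (T u b z : ℂ) : ℂ :=
  1 / 250 * (125 * T^2 + 110741632 * u^6 - 1121702400 * u^5 * b - 94936320 * u^5 * z +
    5366088000 * u^4 * b^2 + 423014400 * u^4 * b * z - 67651200 * u^4 * z^2 - 12071808000 * u^3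
    * b^3 - 489888000 * u^3 * b^2 * z + 167961600 * u^3 * b * z^2 + 23247360 * u^3 * z^3 +
    14152320000 * u^2 * b^4 + 326592000 * u^2 * b^3 * z - 104976000 * u^2 * b^2 * z^2 -
    141004800 * u^2 * b * z^3 + 33747840 * u^2 * z^4 - 9797760000 * u * b^5 + 163296000 * u *
    b^2 * z^3 - 83980800 * u * b * z^4 + 5038848 * u * z^5 + 3755808000 * b^6 - 108864000 * b^3
    * z^3 + 52488000 * b^2 * z^4 + 51840 * z^6)

/-- The derivative `∂²F/∂t_2∂t_2` in the coordinates `T, u, b, z`. -/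
def branchHess22 (u b z : ℂ) : ℂ :=
  32 / 507 * (-35 * u + 66 * b + 45 * z)

/-- The derivative `∂²F/∂t_2∂t_3` in the coordinates `T, u, b, z`. -/
def branchHess23 (T u b z : ℂ) : ℂ :=
  1 / 5 * (5 * T - 22468 * u^3 + 93600 * u^2 * b - 9612 * u^2 * z - 129600 * u * b^2 + 12960 * u
    * b * z - 972 * u * z^2 + 62640 * b^3 + 252 * z^3)

/-- The derivative `∂²F/∂t_2∂t_4` in the coordinates `T, u, b, z`. -/
def branchHess24 (u b z : ℂ) : ℂ :=
  64 / 65 * (-2747 * u^3 + 12240 * u^2 * b - 3915 * u^2 * z - 14175 * u * b^2 + 9720 * u * b * z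
    - 729 * u * z^2 + 9450 * b^3 - 6075 * b^2 * z - 9 * z^3)

/-- The derivative `∂²F/∂t_3∂t_3` in the coordinates `T, u, b, z`. -/
def branchHess33 (u b z : ℂ) : ℂ :=
  4563 / 1250 * (134521 * u^5 - 732150 * u^4 * b + 75645 * u^4 * z + 1476000 * u^3 * b^2 -
    221400 * u^3 * b * z + 33210 * u^3 * z^2 - 1080000 * u^2 * b^3 + 162000 * u^2 * b^2 * z -
    72900 * u^2 * b * z^2 + 79290 * u^2 * z^3 - 221400 * u * b * z^3 + 16605 * u * z^4 + 243000
    * b^5 + 162000 * b^2 * z^3 - 12150 * b * z^4 + 729 * z^5)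

/-- The derivative `∂²F/∂t_3∂t_4` in the coordinates `T, u, b, z`. -/
def branchHess34 (u b z : ℂ) : ℂ :=
  8424 / 625 * (221271 * u^5 - 1552150 * u^4 * b + 137145 * u^4 * z + 4567125 * u^3 * b^2 -
    581400 * u^3 * b * z + 33210 * u^3 * z^2 - 6615000 * u^2 * b^3 + 853875 * u^2 * b^2 * z -
    72900 * u^2 * b * z^2 + 17790 * u^2 * z^3 + 4725000 * u * b^4 - 405000 * u * b^3 * z + 30375
    * u * b^2 * z^2 - 41400 * u * b * z^3 + 9855 * u * z^4 - 1417500 * b^5 + 23625 * b^2 * z^3 -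
    12150 * b * z^4 + 729 * z^5)

/-- The derivative `∂²F/∂t_4∂t_4` in the coordinates `T, u, b, z`. -/
def branchHess44 (u b z : ℂ) : ℂ :=
  1728 / 625 * (1444378 * u^5 - 8331825 * u^4 * b + 1775610 * u^4 * z + 27148500 * u^3 * b^2 -
    8642700 * u^3 * b * z + 597780 * u^3 * z^2 - 43200000 * u^2 * b^3 + 17698500 * u^2 * b^2 * z
    - 1615950 * u^2 * b * z^2 + 113220 * u^2 * z^3 + 24806250 * u * b^4 - 14580000 * u * b^3 * z
    + 1093500 * u * b^2 * z^2 - 272700 * u * b * z^3 + 55890 * u * z^4 + 4556250 * b^4 * z -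
    40500 * b^2 * z^3 - 66825 * b * z^4 + 13122 * z^5)

/-- The invariant `y_1` in the coordinates `T, u, b, z`. -/
def branchY1 (T u b z : ℂ) : ℂ :=
  4 / 19683 * (25 * T^2 + 233600 * T * u^3 - 1209600 * T * u^2 * b - 8640 * T * u^2 * z +
    1909440 * T * u * b^2 - 799200 * T * b^3 + 2880 * T * z^3 + 117059200 * u^6 - 655948800 *
    u^5 * b - 9573120 * u^5 * z + 1444746240 * u^4 * b^2 + 74649600 * u^4 * b * z - 6065280 *
    u^4 * z^2 - 3106805760 * u^3 * b^3 - 249329664 * u^3 * b^2 * z + 22394880 * u^3 * b * z^2 +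
    4124160 * u^3 * z^3 + 5915980800 * u^2 * b^4 + 138101760 * u^2 * b^3 * z - 13436928 * u^2 *
    b^2 * z^2 - 24883200 * u^2 * b * z^3 + 2768256 * u^2 * z^4 - 4721587200 * u * b^5 + 83109888
    * u * b^2 * z^3 - 11197440 * u * b * z^4 - 559872 * u * z^5 + 1227426048 * b^6 - 46033920 *
    b^3 * z^3 + 6718464 * b^2 * z^4 + 176256 * z^6)

/-- The invariant `y_2` in the coordinates `T, u, b, z`. -/
def branchY2 (T u b z : ℂ) : ℂ :=
  16 / 3645 * (50 * T * u - 60 * T * b + 52925 * u^4 - 426336 * u^3 * b - 3780 * u^3 * z +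
    872640 * u^2 * b^2 - 1296 * u^2 * b * z - 810 * u^2 * z^2 - 540000 * u * b^3 + 1260 * u *
    z^3 + 25920 * b^4 + 432 * b * z^3 + 405 * z^4)

/-- The invariant `y_3` in the coordinates `T, u, b, z`. -/
def branchY3 (T u b z : ℂ) : ℂ :=
  2 / 405 * (-5 * T + 23872 * u^3 - 17280 * u^2 * b + 2592 * u^2 * z - 108000 * u * b^2 + 79920
    * b^3 - 864 * z^3)

/-- The derivative `∂y_1/∂t_1` in the coordinates `T, u, b, z`. -/
def branchJac11 (T u b z : ℂ) : ℂ :=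
  40 / 19683 * (5 * T + 23360 * u^3 - 120960 * u^2 * b - 864 * u^2 * z + 190944 * u * b^2 -
    79920 * b^3 + 288 * z^3)

/-- The derivative `∂y_1/∂t_2` in the coordinates `T, u, b, z`. -/
def branchJac12 (T u b z : ℂ) : ℂ :=
  640 / 255879 * (-5 * T - 5540 * u^3 + 43200 * u^2 * b - 7020 * u^2 * z - 144288 * u * b^2 +
    25920 * u * b * z + 1620 * u * z^2 + 79920 * b^3 - 15552 * b^2 * z - 612 * z^3)

/-- The derivative `∂y_1/∂t_3` in the coordinates `T, u, b, z`. -/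
def branchJac13 (T u b z : ℂ) : ℂ :=
  208 / 10935 * (4060 * T * u^2 - 13200 * T * u * b + 9945 * T * b^2 + 4112380 * u^5 - 21289200
    * u^4 * b + 426060 * u^4 * z + 47114496 * u^3 * b^2 - 2190240 * u^3 * b * z - 132840 * u^3 *
    z^2 - 72411840 * u^2 * b^3 + 3087072 * u^2 * b^2 * z + 77760 * u^2 * b * z^2 + 85464 * u^2 *
    z^3 + 71215200 * u * b^4 - 1866240 * u * b^3 * z + 139968 * u * b^2 * z^2 - 332640 * u * b *
    z^3 + 39852 * u * z^4 - 24591600 * b^5 + 432864 * b^2 * z^3 - 58320 * b * z^4 - 2916 * z^5)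

/-- The derivative `∂y_1/∂t_4` in the coordinates `T, u, b, z`. -/
def branchJac14 (T u b z : ℂ) : ℂ :=
  128 / 10935 * (2360 * T * u^2 - 12900 * T * u * b + 20295 * T * b^2 + 12178280 * u^5 -
    68930400 * u^4 * b + 2448360 * u^4 * z + 94509576 * u^3 * b^2 - 16614720 * u^3 * b * z -
    84240 * u^3 * z^2 - 27095040 * u^2 * b^3 + 25763832 * u^2 * b^2 * z - 41616 * u^2 * z^3 +
    82360800 * u * b^4 - 22861440 * u * b^3 * z + 110808 * u * b^2 * z^2 + 889920 * u * b * z^3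
    + 44712 * u * z^4 - 55656720 * b^5 + 6998400 * b^4 * z + 474984 * b^2 * z^3 - 116640 * b *
    z^4 - 17496 * z^5)

/-- The derivative `∂y_2/∂t_1` in the coordinates `T, u, b, z`. -/
def branchJac21 (u b : ℂ) : ℂ :=
  32 / 729 * (5 * u - 6 * b)

/-- The derivative `∂y_2/∂t_2` in the coordinates `T, u, b, z`. -/
def branchJac22 (u b z : ℂ) : ℂ :=
  32 / 9477 * (-35 * u - 12 * b - 15 * z)

/-- The derivative `∂y_2/∂t_3` in the coordinates `T, u, b, z`. -/
def branchJac23 (T u b z : ℂ) : ℂ :=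
  26 / 1215 * (5 * T + 24614 * u^3 - 131760 * u^2 * b + 1098 * u^2 * z + 172800 * u * b^2 - 2160
    * u * b * z + 162 * u * z^2 - 54000 * b^3 + 126 * z^3)

/-- The derivative `∂y_2/∂t_4` in the coordinates `T, u, b, z`. -/
def branchJac24 (T u b z : ℂ) : ℂ :=
  32 / 1215 * (5 * T - 1414 * u^3 - 105840 * u^2 * b + 1278 * u^2 * z + 257850 * u * b^2 - 6480
    * u * b * z + 486 * u * z^2 - 141480 * b^3 + 4050 * b^2 * z + 450 * z^3)

/-- The gradient of the prepotential. -/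
def branchGrad (T u b z : ℂ) : Fin 4 → ℂ :=
  ![branchGrad1 T u b z, branchGrad2 T u b z, branchGrad3 T u b z, branchGrad4 T u b z]

/-- The Hessian matrix of the prepotential. -/
def branchHess (T u b z : ℂ) : Matrix (Fin 4) (Fin 4) ℂ :=
  !![b, branchT3 u b, branchT2 u b z, T;
     branchT3 u b, branchHess22 u b z, branchHess23 T u b z, branchHess24 u b z;
     branchT2 u b z, branchHess23 T u b z, branchHess33 u b z, branchHess34 u b z;
     T, branchHess24 u b z, branchHess34 u b z, branchHess44 u b z]

/-- The basic invariants. -/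
def branchY (T u b z : ℂ) : Fin 4 → ℂ :=
  ![branchY1 T u b z, branchY2 T u b z, branchY3 T u b z, 12 * b]

/-- The Jacobian matrix of the basic invariants with respect to the flat coordinates. -/
def branchJac (T u b z : ℂ) : Matrix (Fin 4) (Fin 4) ℂ :=
  !![branchJac11 T u b z, branchJac12 T u b z, branchJac13 T u b z, branchJac14 T u b z;
     branchJac21 u b, branchJac22 u b z, branchJac23 T u b z, branchJac24 T u b z;
     -2 / 81, 32 / 351, 260 / 9 * (4 * u^2 - 9 * b^2),
       32 / 3 * (40 * u^2 - 100 * u * b + 3 * b^2);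
     0, 0, 0, 12]

/-! ### Substitution of the branch coordinates -/

theorem prepotentialPoly_eq (T u b z : ℂ) :
    prepotentialPoly T (branchT2 u b z) (branchT3 u b) b (8 / 5 * z) =
      branchPotential T u b z := by
  simp only [prepotentialPoly, prepotentialCoeff0, prepotentialCoeff1, prepotentialCoeff2,
    branchT2, branchT3, branchPotential]
  ring

theorem y1Poly_eq (T u b z : ℂ) :
    y1Poly T (branchT2 u b z) (branchT3 u b) b (8 / 5 * z) = branchY1 T u b z := by
  simp only [y1Poly, y1Coeff0, y1Coeff1, y1Coeff2, branchT2, branchT3, branchY1]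
  ring

theorem y2Poly_eq (T u b z : ℂ) :
    y2Poly T (branchT2 u b z) (branchT3 u b) b (8 / 5 * z) = branchY2 T u b z := by
  simp only [y2Poly, branchT2, branchT3, branchY2]
  ring

theorem y3Poly_eq (T u b z : ℂ) :
    y3Poly T (branchT2 u b z) (branchT3 u b) b = branchY3 T u b z := by
  simp only [y3Poly, branchT2, branchT3, branchY3]
  ring

/-- The derivative of `t₂` as a function of `u, b, z` along `(υ, β, ζ)`. -/
def dBranchT2 (u b z υ β ζ : ℂ) : ℂ :=
  26 / 5 * ((246 * u^2 - 360 * u * b + 54 * u * z) * υ + (405 * b^2 - 180 * u^2) * β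
    + 27 * (u^2 - z^2) * ζ)

/-! ### Derivatives along a branch -/

section Derivatives

variable {z : (Fin 4 → ℂ) → ℂ} {t v : Fin 4 → ℂ} {ζ : ℂ}

theorem hasDir_uCoord (v t : Fin 4 → ℂ) : HasDir v uCoord t (uCoord v) := by
  unfold uCoord
  apply HasDir.of_eq
  · exact ((HasDir.const _).mul (HasDir.coord 2)).add ((HasDir.const _).mul (HasDir.coord 3))
  · ring

theorem hasDir_branchT2 (hz : HasDir v z t ζ) :
    HasDir v (fun s => branchT2 (uCoord s) (s 3) (z s)) t
      (dBranchT2 (uCoord t) (t 3) (z t) (uCoord v) (v 3) ζ) := by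
  have hu := hasDir_uCoord v t
  unfold branchT2
  apply HasDir.of_eq
  · repeat' first
      | exact hu | exact hz | exact HasDir.coord _ | exact HasDir.const _ | apply HasDir.add
      | apply HasDir.sub | apply HasDir.pow | apply HasDir.mul
  · simp only [dBranchT2, Nat.cast_ofNat, Nat.reduceSub]; ring

/-- The hypothesis `hζ` is the differentiated cubic. It is used to eliminate `v 1` instead of
solving for ζ, so nothing is divided by u² - z². The ζ-terms then match because ∂F/∂z equals
`branchGrad2` times ∂t₂/∂z. -/
theorem hasDir_branchPotential (hz : HasDir v z t ζ)
    (hζ : v 1 = dBranchT2 (uCoord t) (t 3) (z t) (uCoord v) (v 3) ζ) :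
    HasDir v (fun s => branchPotential (s 0) (uCoord s) (s 3) (z s)) t
      (branchGrad (t 0) (uCoord t) (t 3) (z t) ⬝ᵥ v) := by
  have hu := hasDir_uCoord v t
  unfold branchPotential
  apply HasDir.of_eq
  · repeat' first
      | exact hu | exact hz | exact HasDir.coord _ | exact HasDir.const _ | apply HasDir.add
      | apply HasDir.sub | apply HasDir.pow | apply HasDir.mul
  -- `uCoord` is linear, so this inverts it on directions. After `hζ` is also used, v₁, u(v), v₄ and
  -- ζ are free variables, and the chain rule is a polynomial identity.
  · have h2 : v 2 = 80 / 39 * uCoord v - 48 / 13 * v 3 := by rw [uCoord]; ring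
    simp only [dotProduct, Fin.sum_univ_four, branchGrad, Matrix.cons_val, branchGrad1,
      branchGrad2, branchGrad3, branchGrad4,
      Nat.cast_ofNat, Nat.reduceSub, h2]
    rw [hζ, dBranchT2]
    ring

/-- The same mechanism works one order higher: the z-derivative of each gradient component is the
matching t₂-entry of the Hessian times ∂t₂/∂z, so the Hessian stays polynomial. -/
theorem hasDir_branchGrad1 (hz : HasDir v z t ζ)
    (hζ : v 1 = dBranchT2 (uCoord t) (t 3) (z t) (uCoord v) (v 3) ζ) :
    HasDir v (fun s => branchGrad1 (s 0) (uCoord s) (s 3) (z s)) t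
      ((branchHess (t 0) (uCoord t) (t 3) (z t)).mulVec v 0) := by
  have hu := hasDir_uCoord v t
  unfold branchGrad1
  apply HasDir.of_eq
  · repeat' first
      | exact hu | exact hz | exact HasDir.coord _ | exact HasDir.const _ | apply HasDir.add
      | apply HasDir.sub | apply HasDir.pow | apply HasDir.mul
  · have h2 : v 2 = 80 / 39 * uCoord v - 48 / 13 * v 3 := by rw [uCoord]; ring
    simp only [Matrix.mulVec, dotProduct, Fin.sum_univ_four, branchHess, Matrix.cons_val,
      Matrix.of_apply, branchT2, branchT3,
      Nat.cast_ofNat, Nat.reduceSub, h2]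
    rw [hζ, dBranchT2]
    ring

theorem hasDir_branchGrad2 (hz : HasDir v z t ζ)
    (hζ : v 1 = dBranchT2 (uCoord t) (t 3) (z t) (uCoord v) (v 3) ζ) :
    HasDir v (fun s => branchGrad2 (s 0) (uCoord s) (s 3) (z s)) t
      ((branchHess (t 0) (uCoord t) (t 3) (z t)).mulVec v 1) := by
  have hu := hasDir_uCoord v t
  unfold branchGrad2
  apply HasDir.of_eq
  · repeat' first
      | exact hu | exact hz | exact HasDir.coord _ | exact HasDir.const _ | apply HasDir.add
      | apply HasDir.sub | apply HasDir.pow | apply HasDir.mul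
  · have h2 : v 2 = 80 / 39 * uCoord v - 48 / 13 * v 3 := by rw [uCoord]; ring
    simp only [Matrix.mulVec, dotProduct, Fin.sum_univ_four, branchHess, Matrix.cons_val,
      Matrix.of_apply, branchT3, branchHess22, branchHess23, branchHess24,
      Nat.cast_ofNat, Nat.reduceSub, h2]
    rw [hζ, dBranchT2]
    ring

theorem hasDir_branchGrad3 (hz : HasDir v z t ζ)
    (hζ : v 1 = dBranchT2 (uCoord t) (t 3) (z t) (uCoord v) (v 3) ζ) :
    HasDir v (fun s => branchGrad3 (s 0) (uCoord s) (s 3) (z s)) t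
      ((branchHess (t 0) (uCoord t) (t 3) (z t)).mulVec v 2) := by
  have hu := hasDir_uCoord v t
  unfold branchGrad3
  apply HasDir.of_eq
  · repeat' first
      | exact hu | exact hz | exact HasDir.coord _ | exact HasDir.const _ | apply HasDir.add
      | apply HasDir.sub | apply HasDir.pow | apply HasDir.mul
  · have h2 : v 2 = 80 / 39 * uCoord v - 48 / 13 * v 3 := by rw [uCoord]; ring
    simp only [Matrix.mulVec, dotProduct, Fin.sum_univ_four, branchHess, Matrix.cons_val,
      Matrix.of_apply, branchT2, branchHess23, branchHess33, branchHess34,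
      Nat.cast_ofNat, Nat.reduceSub, h2]
    rw [hζ, dBranchT2]
    ring

theorem hasDir_branchGrad4 (hz : HasDir v z t ζ)
    (hζ : v 1 = dBranchT2 (uCoord t) (t 3) (z t) (uCoord v) (v 3) ζ) :
    HasDir v (fun s => branchGrad4 (s 0) (uCoord s) (s 3) (z s)) t
      ((branchHess (t 0) (uCoord t) (t 3) (z t)).mulVec v 3) := by
  have hu := hasDir_uCoord v t
  unfold branchGrad4
  apply HasDir.of_eq
  · repeat' first
      | exact hu | exact hz | exact HasDir.coord _ | exact HasDir.const _ | apply HasDir.add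
      | apply HasDir.sub | apply HasDir.pow | apply HasDir.mul
  · have h2 : v 2 = 80 / 39 * uCoord v - 48 / 13 * v 3 := by rw [uCoord]; ring
    simp only [Matrix.mulVec, dotProduct, Fin.sum_univ_four, branchHess, Matrix.cons_val,
      Matrix.of_apply, branchHess24, branchHess34, branchHess44,
      Nat.cast_ofNat, Nat.reduceSub, h2]
    rw [hζ, dBranchT2]
    ring

theorem hasDir_branchY1 (hz : HasDir v z t ζ)
    (hζ : v 1 = dBranchT2 (uCoord t) (t 3) (z t) (uCoord v) (v 3) ζ) :
    HasDir v (fun s => branchY1 (s 0) (uCoord s) (s 3) (z s)) t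
      ((branchJac (t 0) (uCoord t) (t 3) (z t)).mulVec v 0) := by
  have hu := hasDir_uCoord v t
  unfold branchY1
  apply HasDir.of_eq
  · repeat' first
      | exact hu | exact hz | exact HasDir.coord _ | exact HasDir.const _ | apply HasDir.add
      | apply HasDir.sub | apply HasDir.pow | apply HasDir.mul
  · have h2 : v 2 = 80 / 39 * uCoord v - 48 / 13 * v 3 := by rw [uCoord]; ring
    simp only [Matrix.mulVec, dotProduct, Fin.sum_univ_four, branchJac, Matrix.cons_val,
      Matrix.of_apply, branchJac11, branchJac12, branchJac13, branchJac14,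
      Nat.cast_ofNat, Nat.reduceSub, h2]
    rw [hζ, dBranchT2]
    ring

theorem hasDir_branchY2 (hz : HasDir v z t ζ)
    (hζ : v 1 = dBranchT2 (uCoord t) (t 3) (z t) (uCoord v) (v 3) ζ) :
    HasDir v (fun s => branchY2 (s 0) (uCoord s) (s 3) (z s)) t
      ((branchJac (t 0) (uCoord t) (t 3) (z t)).mulVec v 1) := by
  have hu := hasDir_uCoord v t
  unfold branchY2
  apply HasDir.of_eq
  · repeat' first
      | exact hu | exact hz | exact HasDir.coord _ | exact HasDir.const _ | apply HasDir.add
      | apply HasDir.sub | apply HasDir.pow | apply HasDir.mul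
  · have h2 : v 2 = 80 / 39 * uCoord v - 48 / 13 * v 3 := by rw [uCoord]; ring
    simp only [Matrix.mulVec, dotProduct, Fin.sum_univ_four, branchJac, Matrix.cons_val,
      Matrix.of_apply, branchJac21, branchJac22, branchJac23, branchJac24,
      Nat.cast_ofNat, Nat.reduceSub, h2]
    rw [hζ, dBranchT2]
    ring

theorem hasDir_branchY3 (hz : HasDir v z t ζ)
    (hζ : v 1 = dBranchT2 (uCoord t) (t 3) (z t) (uCoord v) (v 3) ζ) :
    HasDir v (fun s => branchY3 (s 0) (uCoord s) (s 3) (z s)) t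
      ((branchJac (t 0) (uCoord t) (t 3) (z t)).mulVec v 2) := by
  have hu := hasDir_uCoord v t
  unfold branchY3
  apply HasDir.of_eq
  · repeat' first
      | exact hu | exact hz | exact HasDir.coord _ | exact HasDir.const _ | apply HasDir.add
      | apply HasDir.sub | apply HasDir.pow | apply HasDir.mul
  · have h2 : v 2 = 80 / 39 * uCoord v - 48 / 13 * v 3 := by rw [uCoord]; ring
    simp only [Matrix.mulVec, dotProduct, Fin.sum_univ_four, branchJac, Matrix.cons_val,
      Matrix.of_apply,
      Nat.cast_ofNat, Nat.reduceSub, h2]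
    rw [hζ, dBranchT2]
    ring

theorem hasDir_branchGrad (hz : HasDir v z t ζ)
    (hζ : v 1 = dBranchT2 (uCoord t) (t 3) (z t) (uCoord v) (v 3) ζ) (j : Fin 4) :
    HasDir v (fun s => branchGrad (s 0) (uCoord s) (s 3) (z s) j) t
      ((branchHess (t 0) (uCoord t) (t 3) (z t)).mulVec v j) := by
  fin_cases j
  exacts [hasDir_branchGrad1 hz hζ, hasDir_branchGrad2 hz hζ, hasDir_branchGrad3 hz hζ,
    hasDir_branchGrad4 hz hζ]

theorem hasDir_branchY (hz : HasDir v z t ζ)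
    (hζ : v 1 = dBranchT2 (uCoord t) (t 3) (z t) (uCoord v) (v 3) ζ) (j : Fin 4) :
    HasDir v (fun s => branchY (s 0) (uCoord s) (s 3) (z s) j) t
      ((branchJac (t 0) (uCoord t) (t 3) (z t)).mulVec v j) := by
  fin_cases j
  · exact hasDir_branchY1 hz hζ
  · exact hasDir_branchY2 hz hζ
  · exact hasDir_branchY3 hz hζ
  · refine HasDir.of_eq ((HasDir.const 12).mul (HasDir.coord 3)) ?_
    simp [branchJac, Matrix.mulVec, dotProduct, Fin.sum_univ_four]

end Derivatives

/-! ### The intersection form in flat coordinates -/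

/-- The degrees of the flat coordinates. -/
def flatDegree : Fin 4 → ℂ := ![1, 1, 1 / 3, 1 / 3]

/-- The intersection form in the coordinates `T, u, b, z`. -/
def branchForm (T u b z : ℂ) : Matrix (Fin 4) (Fin 4) ℂ :=
  Matrix.of fun i j =>
    (7 / 3 - flatDegree i.rev - flatDegree j.rev) * branchHess T u b z i.rev j.rev

theorem euler_apply (t : Fin 4 → ℂ) (l : Fin 4) : euler t l = flatDegree l * t l := by
  fin_cases l <;> simp [euler, flatDegree]

theorem branchHess_symm (T u b z : ℂ) (i j : Fin 4) :
    branchHess T u b z i j = branchHess T u b z j i := by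
  fin_cases i <;> fin_cases j <;> rfl

/-- Euler's relation for the gradient of the prepotential. -/
theorem branchHess_mulVec_euler (T u b z : ℂ) (j : Fin 4) :
    (branchHess T u b z).mulVec (euler ![T, branchT2 u b z, branchT3 u b, b]) j =
      (7 / 3 - flatDegree j) * branchGrad T u b z j := by
  fin_cases j <;>
    simp only [Matrix.mulVec, dotProduct, Fin.sum_univ_four, branchHess, branchGrad, euler,
      flatDegree, Matrix.cons_val, Matrix.of_apply, branchHess22, branchHess23, branchHess24,
      branchHess33, branchHess34, branchHess44, branchT2, branchT3, branchGrad1, branchGrad2,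
      branchGrad3, branchGrad4, Fin.zero_eta, Fin.mk_one, Fin.reduceFinMk] <;> ring

/-- The algebraic core of the flat-coordinate claim. On the branch T, u, b, z are free, so no
reduction modulo the cubic is needed and each entry is a plain polynomial identity. -/
theorem branchJac_mul_branchForm (T u b z : ℂ) :
    branchJac T u b z * branchForm T u b z * (branchJac T u b z).transpose =
      saitoForm (branchY T u b z 0) (branchY T u b z 1) (branchY T u b z 2)
        (branchY T u b z 3) := by
  ext i j
  fin_cases i <;> fin_cases j <;>
    simp only [branchJac, branchForm, branchHess, branchY, flatDegree, saitoForm,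
      Matrix.mul_apply, Matrix.transpose_apply, Fin.sum_univ_four, Matrix.of_apply,
      Matrix.cons_val, Fin.zero_eta, Fin.mk_one, Fin.reduceFinMk, Fin.reduceRev,
      branchHess22, branchHess23, branchHess24, branchHess33, branchHess34, branchHess44,
      branchT2, branchT3, branchJac11, branchJac12, branchJac13, branchJac14, branchJac21,
      branchJac22, branchJac23, branchJac24, branchY1, branchY2, branchY3] <;> ring

section Branch

variable {z : (Fin 4 → ℂ) → ℂ} {t : Fin 4 → ℂ}

theorem differentiableAt_branchHess (hz : DifferentiableAt ℂ z t) (i j : Fin 4) :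
    DifferentiableAt ℂ (fun s => branchHess (s 0) (uCoord s) (s 3) (z s) i j) t := by
  have hu : DifferentiableAt ℂ uCoord t := (hasDir_uCoord 0 t).1
  fin_cases i <;> fin_cases j <;>
    simp only [branchHess, Matrix.of_apply, Matrix.cons_val, branchHess22, branchHess23,
      branchHess24, branchHess33, branchHess34, branchHess44, branchT2, branchT3, Fin.zero_eta,
      Fin.mk_one, Fin.reduceFinMk] <;> fun_prop

end Branch

/-- The coordinate `z = 5 Z / 8`. -/
def zCoord (Z : (Fin 4 → ℂ) → ℂ) (t : Fin 4 → ℂ) : ℂ := 5 / 8 * Z t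

/-! ### Transfer to the flat coordinates on U -/

section FlatCoordinates

variable {U : Set (Fin 4 → ℂ)} {Z : (Fin 4 → ℂ) → ℂ}

theorem eq_branchT2_of_cubic_eq_zero {t : Fin 4 → ℂ} (h : cubic (t 1) (t 2) (t 3) (Z t) = 0) :
    t 1 = branchT2 (uCoord t) (t 3) (zCoord Z t) := by
  rw [cubic] at h
  rw [branchT2, uCoord, zCoord]
  -- The coefficient of t₂ in the cubic is 256 / 2925.
  linear_combination (2925 / 256) * h

theorem eq_branchT3 (t : Fin 4 → ℂ) : t 2 = branchT3 (uCoord t) (t 3) := by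
  rw [branchT3, uCoord]; ring

theorem eq_zCoord (t : Fin 4 → ℂ) : Z t = 8 / 5 * zCoord Z t := by
  rw [zCoord]; ring

/-- Implicit differentiation of the cubic: near t the coordinate t₂ agrees with its expression in u,
b, z, so the two have the same derivative. -/
theorem hasDir_zCoord (hU : IsOpen U) (hZ : DifferentiableOn ℂ Z U)
    (hP : ∀ t ∈ U, cubic (t 1) (t 2) (t 3) (Z t) = 0) {t : Fin 4 → ℂ} (ht : t ∈ U)
    (v : Fin 4 → ℂ) :
    ∃ ζ, HasDir v (zCoord Z) t ζ ∧
      v 1 = dBranchT2 (uCoord t) (t 3) (zCoord Z t) (uCoord v) (v 3) ζ := by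
  have hd : DifferentiableAt ℂ (zCoord Z) t :=
    (hZ.differentiableAt (hU.mem_nhds ht)).const_mul _
  refine ⟨_, .of_differentiableAt hd, ?_⟩
  refine HasDir.unique (HasDir.coord 1)
    ((hasDir_branchT2 (.of_differentiableAt hd)).congr_of_eventuallyEq ?_)
  filter_upwards [hU.mem_nhds ht] with s hs using eq_branchT2_of_cubic_eq_zero (hP s hs)

theorem yFlat_eq (hP : ∀ t ∈ U, cubic (t 1) (t 2) (t 3) (Z t) = 0) {t : Fin 4 → ℂ}
    (ht : t ∈ U) (i : Fin 4) :
    yFlat Z i t = branchY (t 0) (uCoord t) (t 3) (zCoord Z t) i := by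
  have h1 := eq_branchT2_of_cubic_eq_zero (hP t ht)
  have h2 := eq_branchT3 t
  have h3 := eq_zCoord (Z := Z) t
  fin_cases i
  · exact (by rw [← h1, ← h2, ← h3] : y1Poly (t 0) (t 1) (t 2) (t 3) (Z t) = _).trans
      (y1Poly_eq _ _ _ _)
  · exact (by rw [← h1, ← h2, ← h3] : y2Poly (t 0) (t 1) (t 2) (t 3) (Z t) = _).trans
      (y2Poly_eq _ _ _ _)
  · exact (by rw [← h1, ← h2] : y3Poly (t 0) (t 1) (t 2) (t 3) = _).trans
      (y3Poly_eq _ _ _ (zCoord Z t))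
  · rfl

theorem prepotential_eq (hP : ∀ t ∈ U, cubic (t 1) (t 2) (t 3) (Z t) = 0) {t : Fin 4 → ℂ}
    (ht : t ∈ U) :
    prepotential Z t = branchPotential (t 0) (uCoord t) (t 3) (zCoord Z t) := by
  rw [← prepotentialPoly_eq, ← eq_branchT2_of_cubic_eq_zero (hP t ht), ← eq_branchT3,
    ← eq_zCoord, prepotential]

theorem pd_yFlat (hU : IsOpen U) (hZ : DifferentiableOn ℂ Z U)
    (hP : ∀ t ∈ U, cubic (t 1) (t 2) (t 3) (Z t) = 0) {t : Fin 4 → ℂ} (ht : t ∈ U)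
    (i l : Fin 4) :
    pd l (yFlat Z i) t = branchJac (t 0) (uCoord t) (t 3) (zCoord Z t) i l := by
  obtain ⟨ζ, hz, hζ⟩ := hasDir_zCoord hU hZ hP ht (Pi.single l 1)
  rw [pd_congr (g := fun s => branchY (s 0) (uCoord s) (s 3) (zCoord Z s) i)
    (by filter_upwards [hU.mem_nhds ht] with s hs using yFlat_eq hP hs i),
    (hasDir_branchY hz hζ i).pd_eq, Matrix.mulVec_single_one]
  rfl

theorem pd_prepotential (hU : IsOpen U) (hZ : DifferentiableOn ℂ Z U)
    (hP : ∀ t ∈ U, cubic (t 1) (t 2) (t 3) (Z t) = 0) {t : Fin 4 → ℂ} (ht : t ∈ U)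
    (k : Fin 4) :
    pd k (prepotential Z) t = branchGrad (t 0) (uCoord t) (t 3) (zCoord Z t) k := by
  obtain ⟨ζ, hz, hζ⟩ := hasDir_zCoord hU hZ hP ht (Pi.single k 1)
  rw [pd_congr (g := fun s => branchPotential (s 0) (uCoord s) (s 3) (zCoord Z s))
    (by filter_upwards [hU.mem_nhds ht] with s hs using prepotential_eq hP hs),
    (hasDir_branchPotential hz hζ).pd_eq, dotProduct_single, mul_one]

theorem pd_branchGrad (hU : IsOpen U) (hZ : DifferentiableOn ℂ Z U)
    (hP : ∀ t ∈ U, cubic (t 1) (t 2) (t 3) (Z t) = 0) {t : Fin 4 → ℂ} (ht : t ∈ U)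
    (j k : Fin 4) :
    pd j (fun s => branchGrad (s 0) (uCoord s) (s 3) (zCoord Z s) k) t =
      branchHess (t 0) (uCoord t) (t 3) (zCoord Z t) k j := by
  obtain ⟨ζ, hz, hζ⟩ := hasDir_zCoord hU hZ hP ht (Pi.single j 1)
  rw [(hasDir_branchGrad hz hζ k).pd_eq, Matrix.mulVec_single_one]
  rfl

theorem pd_pd_prepotential (hU : IsOpen U) (hZ : DifferentiableOn ℂ Z U)
    (hP : ∀ t ∈ U, cubic (t 1) (t 2) (t 3) (Z t) = 0) {t : Fin 4 → ℂ} (ht : t ∈ U)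
    (j k : Fin 4) :
    pd j (pd k (prepotential Z)) t = branchHess (t 0) (uCoord t) (t 3) (zCoord Z t) j k := by
  rw [pd_congr (g := fun s => branchGrad (s 0) (uCoord s) (s 3) (zCoord Z s) k)
    (by filter_upwards [hU.mem_nhds ht] with s hs using pd_prepotential hU hZ hP hs k),
    pd_branchGrad hU hZ hP ht, branchHess_symm]

theorem cLow_prepotential (hU : IsOpen U) (hZ : DifferentiableOn ℂ Z U)
    (hP : ∀ t ∈ U, cubic (t 1) (t 2) (t 3) (Z t) = 0) {t : Fin 4 → ℂ} (ht : t ∈ U)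
    (i j k : Fin 4) :
    cLow (prepotential Z) i j k t =
      pd i (fun s => branchHess (s 0) (uCoord s) (s 3) (zCoord Z s) j k) t :=
  pd_congr (by
    filter_upwards [hU.mem_nhds ht] with s hs using pd_pd_prepotential hU hZ hP hs j k)

/-! ### Flat metric and Euler contraction -/

/-- The exchange matrix, which is the flat metric. -/
def exchange : Matrix (Fin 4) (Fin 4) ℂ := Matrix.of fun i j => if j = i.rev then 1 else 0

theorem exchange_mul_self : exchange * exchange = 1 := by
  ext i j
  rw [Matrix.mul_apply, Finset.sum_eq_single i.rev] <;>
    simp +contextual [exchange, Matrix.one_apply, eq_comm (a := i)]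

theorem eta_prepotential (hU : IsOpen U) (hZ : DifferentiableOn ℂ Z U)
    (hP : ∀ t ∈ U, cubic (t 1) (t 2) (t 3) (Z t) = 0) {t : Fin 4 → ℂ} (ht : t ∈ U) :
    eta (prepotential Z) t = exchange := by
  ext i j
  -- The t₁-column of the Hessian is (t₄, t₃, t₂, t₁), the coordinates in reverse order.
  rw [eta, Matrix.of_apply, cLow_prepotential hU hZ hP ht, pd_congr (g := fun s => s j.rev),
    (HasDir.coord j.rev).pd_eq]
  · simp [exchange, Pi.single_apply, Fin.rev_eq_iff]
  · filter_upwards [hU.mem_nhds ht] with s hs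
    fin_cases j
    · rfl
    · exact (eq_branchT3 s).symm
    · exact (eq_branchT2_of_cubic_eq_zero (hP s hs)).symm
    · rfl

theorem cUp_prepotential (hU : IsOpen U) (hZ : DifferentiableOn ℂ Z U)
    (hP : ∀ t ∈ U, cubic (t 1) (t 2) (t 3) (Z t) = 0) {t : Fin 4 → ℂ} (ht : t ∈ U)
    (i j k : Fin 4) :
    cUp (prepotential Z) i j k t = cLow (prepotential Z) i.rev j.rev k t := by
  have h : exchange⁻¹ = exchange := Matrix.inv_eq_left_inv exchange_mul_self
  rw [cUp, eta_prepotential hU hZ hP ht, h]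
  simp [exchange]

/-- Euler's relation for the gradient, differentiated along t_i by the product rule. The third
derivatives enter only as derivatives of the Hessian, whose differentiability suffices. -/
theorem sum_euler_mul_cLow (hU : IsOpen U) (hZ : DifferentiableOn ℂ Z U)
    (hP : ∀ t ∈ U, cubic (t 1) (t 2) (t 3) (Z t) = 0) {t : Fin 4 → ℂ} (ht : t ∈ U)
    (i j : Fin 4) :
    ∑ l, euler t l * cLow (prepotential Z) i j l t =
      (7 / 3 - flatDegree i - flatDegree j) *
        branchHess (t 0) (uCoord t) (t 3) (zCoord Z t) i j := by
  have hz : DifferentiableAt ℂ (zCoord Z) t := by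
    obtain ⟨ζ, hz, -⟩ := hasDir_zCoord hU hZ hP ht 0
    exact hz.1
  have hL : HasDir (Pi.single i 1)
      (fun s => ∑ l, flatDegree l * s l *
        branchHess (s 0) (uCoord s) (s 3) (zCoord Z s) j l) t
      (∑ l, ((0 * t l + flatDegree l * (Pi.single i 1 : Fin 4 → ℂ) l) *
          branchHess (t 0) (uCoord t) (t 3) (zCoord Z t) j l +
        flatDegree l * t l * cLow (prepotential Z) i j l t)) := by
    refine HasDir.sum fun l _ => ((HasDir.const _).mul (HasDir.coord l)).mul ?_
    rw [cLow_prepotential hU hZ hP ht]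
    exact .of_differentiableAt (differentiableAt_branchHess hz j l)
  obtain ⟨ζ, hz', hζ⟩ := hasDir_zCoord hU hZ hP ht (Pi.single i 1)
  have hR := (HasDir.const (7 / 3 - flatDegree j)).mul (hasDir_branchGrad hz' hζ j)
  -- Euler's relation holds on the whole neighbourhood U of t, so its two sides may be
  -- differentiated at t.
  have h := hL.unique (hR.congr_of_eventuallyEq (by
    filter_upwards [hU.mem_nhds ht] with s hs
    rw [← branchHess_mulVec_euler, Matrix.mulVec, dotProduct]
    refine Finset.sum_congr rfl fun l _ => ?_
    rw [← eq_branchT2_of_cubic_eq_zero (hP s hs), ← eq_branchT3, mul_comm (flatDegree l * s l),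
      euler_apply]
    congr 2
    fin_cases l <;> rfl))
  -- Differentiating the coefficients of the Euler field leaves only the term d_i F_{ji}, which
  -- moves to the right to give the weight 7/3 - d_i - d_j.
  simp only [zero_mul, zero_add, Finset.sum_add_distrib, Matrix.mulVec_single_one,
    Matrix.col_apply, Pi.single_apply, mul_ite, mul_one, mul_zero, ite_mul,
    Finset.sum_ite_eq', Finset.mem_univ, if_true] at h
  simp only [euler_apply]
  rw [branchHess_symm _ _ _ _ i j]
  linear_combination h

theorem intersectionForm_prepotential (hU : IsOpen U) (hZ : DifferentiableOn ℂ Z U)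
    (hP : ∀ t ∈ U, cubic (t 1) (t 2) (t 3) (Z t) = 0) {t : Fin 4 → ℂ} (ht : t ∈ U) :
    intersectionForm (prepotential Z) t =
      branchForm (t 0) (uCoord t) (t 3) (zCoord Z t) := by
  ext i j
  simp only [intersectionForm, branchForm, Matrix.of_apply, cUp_prepotential hU hZ hP ht,
    sum_euler_mul_cLow hU hZ hP ht]

end FlatCoordinates

end F4a2

end

/-! ### The main theorem -/

theorem mainTheorem4 (U : Set (Fin 4 → ℂ)) (hU : IsOpen U) (Z : (Fin 4 → ℂ) → ℂ)
    (hZ : DifferentiableOn ℂ Z U)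
    (hP : ∀ t ∈ U, F4a2.cubic (t 1) (t 2) (t 3) (Z t) = 0) :
    (∀ x : Fin 4 → ℂ,
      F4a2.transform (fun _ => 1) F4a2.invariants x =
        F4a2.saitoForm (F4a2.invariants 0 x) (F4a2.invariants 1 x)
          (F4a2.invariants 2 x) (F4a2.invariants 3 x)) ∧
    (∀ t ∈ U,
      F4a2.transform (F4a2.intersectionForm (F4a2.prepotential Z)) (F4a2.yFlat Z) t =
        F4a2.saitoForm (F4a2.yFlat Z 0 t) (F4a2.yFlat Z 1 t)
          (F4a2.yFlat Z 2 t) (F4a2.yFlat Z 3 t)) := by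
  refine ⟨F4a2.transform_one_invariants, fun t ht => ?_⟩
  rw [F4a2.transform_eq_mul _ _ _ fun i l => F4a2.pd_yFlat hU hZ hP ht i l,
    F4a2.intersectionForm_prepotential hU hZ hP ht, F4a2.branchJac_mul_branchForm]
  simp only [F4a2.yFlat_eq hP ht]
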